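/- Let $n$ and $p$ be nonnegative integers, let $[n]=\{1,\dots,n\}$, and let $2^{[n]}$ be the set of all subsets of $[n]$. For a family $A\subseteq 2^{[n]}$ put $$C^p[A]=\{y\in 2^{[n]} : |x\triangle y|\le p \text{ for every } x\in A\}.$$ Order $2^{[n]}$ by the simplicial order: for distinct $x,y\in 2^{[n]}$, $x$ precedes $y$ if either $|x|<|y|$, or $|x|=|y|$ and $\min(x\triangle y)\in x$. For $0\le m\le 2^n$ let $\mathcal I_m$ be the set of the first $m$ elements of $2^{[n]}$ in this order. Then, for every family $A\subseteq 2^{[n]}$, $$|C^p[A]|\le \bigl|C^p[\mathcal I_{|A|}]\bigr|.$$ -/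

import Mathlib

namespace PowerCube

variable {α : Type*} [Fintype α] [LinearOrder α]

/-- The simplicial order on the subsets of a finite linearly ordered ground set: `x` precedes `y`
if `|x| < |y|`, or `|x| = |y|` and the least element of the symmetric difference of `x` and `y`
belongs to `x`. -/
def SimplicialLT (x y : Finset α) : Prop :=
  x.card < y.card ∨
    (x.card = y.card ∧ ∃ i ∈ symmDiff x y, (∀ j ∈ symmDiff x y, i ≤ j) ∧ i ∈ x)

instance instDecidableSimplicialLT (x y : Finset α) : Decidable (SimplicialLT x y) := by
  unfold SimplicialLT
  infer_instance

/-- The initial segment of size `m`: the first `m` subsets of the ground set in the simplicial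
order, that is, those that are preceded by fewer than `m` subsets. -/
def initialSegment (α : Type*) [Fintype α] [LinearOrder α] (m : ℕ) : Finset (Finset α) :=
  Finset.univ.filter fun y =>
    (Finset.univ.filter fun x : Finset α => SimplicialLT x y).card < m

/-- `commonNear p A` is `C^p[A]`: all subsets `y` of the ground set whose symmetric difference
with every member `x` of the family `A` has at most `p` elements. -/
def commonNear (p : ℕ) (A : Finset (Finset α)) : Finset (Finset α) :=
  Finset.univ.filter fun y => ∀ x ∈ A, (symmDiff x y).card ≤ p

theorem SimplicialLT.irrefl (x : Finset α) : ¬ SimplicialLT x x := by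
  simp [SimplicialLT]

theorem SimplicialLT.trans {x y z : Finset α} (h : SimplicialLT x y) (h' : SimplicialLT y z) :
    SimplicialLT x z := by
  rcases h with h | ⟨h, i, hi, hmin, hix⟩ <;> rcases h' with h' | ⟨h', j, hj, hmin', hjy⟩
  · exact Or.inl (by omega)
  · exact Or.inl (by omega)
  · exact Or.inl (by omega)
  · refine Or.inr ⟨by omega, min i j, ?_⟩
    simp only [Finset.mem_symmDiff] at *
    rcases lt_trichotomy i j with hij | hij | hij
    · rw [min_eq_left hij.le]; grind
    · grind
    · rw [min_eq_right hij.le]; grind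

theorem SimplicialLT.total {x y : Finset α} (h : x ≠ y) : SimplicialLT x y ∨ SimplicialLT y x := by
  have hne : (symmDiff x y).Nonempty := by
    rw [Finset.nonempty_iff_ne_empty]
    exact fun h0 => h (symmDiff_eq_bot.1 h0)
  have hm := Finset.min'_mem _ hne
  have hl := fun j hj => Finset.min'_le (symmDiff x y) j hj
  have hc := symmDiff_comm x y
  rcases lt_trichotomy x.card y.card with hcard | hcard | hcard
  · exact Or.inl (Or.inl hcard)
  · rcases Finset.mem_symmDiff.1 hm with hx | hy
    · exact Or.inl (Or.inr ⟨hcard, _, hm, hl, hx.1⟩)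
    · exact Or.inr (Or.inr ⟨hcard.symm, _, hc ▸ hm, hc ▸ hl, hy.1⟩)
  · exact Or.inr (Or.inl hcard)

/-- Initial segments are closed under passing to predecessors in the simplicial order. -/
theorem mem_initialSegment_of_lt {m : ℕ} {x y : Finset α} (h : SimplicialLT x y)
    (hy : y ∈ initialSegment α m) : x ∈ initialSegment α m := by
  simp only [initialSegment, Finset.mem_filter, Finset.mem_univ, true_and] at hy ⊢
  refine lt_of_le_of_lt (Finset.card_le_card fun z hz => ?_) hy
  simp only [Finset.mem_filter, Finset.mem_univ, true_and] at hz ⊢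
  exact hz.trans h

/-- The initial segment of size `m` has exactly `m` members. -/
theorem card_initialSegment {m : ℕ} (hm : m ≤ 2 ^ Fintype.card α) :
    (initialSegment α m).card = m := by
  let r : Finset α → ℕ := fun y => (Finset.univ.filter fun x : Finset α => SimplicialLT x y).card
  have hr : ∀ x y, SimplicialLT x y → r x < r y := fun x y h => by
    refine Finset.card_lt_card (Finset.ssubset_iff_of_subset (fun z hz => ?_) |>.2 ⟨x, ?_, ?_⟩)
    · simp only [Finset.mem_filter, Finset.mem_univ, true_and] at hz ⊢
      exact hz.trans h
    · simpa using h
    · simpa using SimplicialLT.irrefl x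
  have hinj : Function.Injective r := fun x y hxy => by
    by_contra hne
    rcases SimplicialLT.total hne with h | h
    · exact absurd hxy (hr _ _ h).ne
    · exact absurd hxy (hr _ _ h).ne'
  have hlt : ∀ y, r y < 2 ^ Fintype.card α := fun y => by
    have : r y < (Finset.univ : Finset (Finset α)).card :=
      Finset.card_lt_card (Finset.filter_ssubset.2 ⟨y, Finset.mem_univ _, SimplicialLT.irrefl y⟩)
    simpa using this
  have himg : Finset.univ.image r = Finset.range (2 ^ Fintype.card α) := by
    refine Finset.eq_of_subset_of_card_le (fun k hk => ?_) ?_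
    · obtain ⟨y, -, rfl⟩ := Finset.mem_image.1 hk
      exact Finset.mem_range.2 (hlt y)
    · rw [Finset.card_image_of_injective _ hinj]; simp
  have : (initialSegment α m).image r = Finset.range m := by
    ext k
    simp only [Finset.mem_image, Finset.mem_range]
    constructor
    · rintro ⟨y, hy, rfl⟩
      simpa [initialSegment] using hy
    · intro hk
      have : k ∈ Finset.univ.image r := by rw [himg]; exact Finset.mem_range.2 (by omega)
      obtain ⟨y, -, rfl⟩ := Finset.mem_image.1 this
      exact ⟨y, by simpa [initialSegment] using hk, rfl⟩
  rw [← Finset.card_image_of_injective _ hinj, this, Finset.card_range]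

end PowerCube

namespace PowerCube

/-! The distances from `x` to `y` and to `yᶜ` add up to `n`. So for `p < n` complementation carries
`commonNear p A` onto the complement of the ball of radius `t = n - p - 1` about `A`, and the
theorem becomes Harper's vertex-isoperimetric inequality: initial segments minimise `ball t`. As
balls about initial families are initial (`IsInitial.ball`), radius 1 suffices. There one inducts on
the dimension by compression: making both `i`-sections initial does not enlarge the ball and, if a
section changes, lowers the sum of ranks. A family with all sections initial is itself initial or
differs from an initial one by exchanging some `xᶜ` for `x`; this case is settled directly in
`card_ball_le_of_isInitial_sec`. -/

theorem card_symmDiff_erase_le {α : Type*} [DecidableEq α] (x : Finset α) (i : α) : (symmDiff (x.erase i) x).card ≤ 1 := by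
  refine (Finset.card_le_card (t := {i}) fun j hj => ?_).trans (Finset.card_singleton i).le
  grind [Finset.mem_symmDiff]

theorem card_symmDiff_triangle {α : Type*} [DecidableEq α] (x y z : Finset α) :
    (symmDiff x z).card ≤ (symmDiff x y).card + (symmDiff y z).card := by
  refine (Finset.card_le_card (t := symmDiff x y ∪ symmDiff y z) fun j hj => ?_).trans
    (Finset.card_union_le _ _)
  grind [Finset.mem_symmDiff]

theorem card_le_two_pow {α : Type*} [Fintype α] (A : Finset (Finset α)) : A.card ≤ 2 ^ Fintype.card α := by
  simpa using Finset.card_le_univ A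

/-! ### Hamming balls and initial families. -/

section General

variable {α : Type*} [Fintype α] [LinearOrder α]

/-- The sets at Hamming distance at most `t` from some member of the family `A`. -/
def ball (t : ℕ) (A : Finset (Finset α)) : Finset (Finset α) :=
  Finset.univ.filter fun y => ∃ x ∈ A, (symmDiff x y).card ≤ t

theorem mem_ball {t : ℕ} {A : Finset (Finset α)} {y : Finset α} :
    y ∈ ball t A ↔ ∃ x ∈ A, (symmDiff x y).card ≤ t := by
  simp [ball]

theorem ball_mono {t : ℕ} {A B : Finset (Finset α)} (h : A ⊆ B) : ball t A ⊆ ball t B := by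
  intro y hy
  obtain ⟨x, hx, hxy⟩ := mem_ball.1 hy
  exact mem_ball.2 ⟨x, h hx, hxy⟩

theorem subset_ball (t : ℕ) (A : Finset (Finset α)) : A ⊆ ball t A :=
  fun x hx => mem_ball.2 ⟨x, hx, by simp⟩

theorem ball_succ (t : ℕ) (A : Finset (Finset α)) : ball (t + 1) A = ball 1 (ball t A) := by
  ext y
  simp only [mem_ball]
  constructor
  · rintro ⟨x, hx, hxy⟩
    by_cases h : (symmDiff x y).card ≤ t
    · exact ⟨y, ⟨x, hx, h⟩, by simp⟩
    · obtain ⟨j, hj⟩ : (symmDiff x y).Nonempty := Finset.card_pos.1 (by omega)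
      refine ⟨symmDiff y {j}, ⟨x, hx, ?_⟩, ?_⟩
      · have : symmDiff x (symmDiff y {j}) = (symmDiff x y).erase j := by
          ext k
          grind [Finset.mem_symmDiff]
        rw [this, Finset.card_erase_of_mem hj]
        omega
      · have : symmDiff (symmDiff y {j}) y = {j} := by
          ext k
          grind [Finset.mem_symmDiff]
        simp [this]
  · rintro ⟨z, ⟨x, hx, hxz⟩, hzy⟩
    exact ⟨x, hx, (card_symmDiff_triangle x z y).trans (by omega)⟩

/-- A family closed under passing to predecessors in the simplicial order. -/
def IsInitial (A : Finset (Finset α)) : Prop :=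
  ∀ ⦃x y⦄, SimplicialLT x y → y ∈ A → x ∈ A

theorem isInitial_initialSegment (m : ℕ) : IsInitial (initialSegment α m) :=
  fun _ _ h hy => mem_initialSegment_of_lt h hy

theorem IsInitial.subset_total {A B : Finset (Finset α)} (hA : IsInitial A) (hB : IsInitial B) :
    A ⊆ B ∨ B ⊆ A := by
  by_contra! h
  obtain ⟨x, hxA, hxB⟩ := Finset.not_subset.1 h.1
  obtain ⟨y, hyB, hyA⟩ := Finset.not_subset.1 h.2
  rcases SimplicialLT.total (x := x) (y := y) (by grind) with h | h
  · exact hxB (hB h hyB)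
  · exact hyA (hA h hxA)

theorem IsInitial.subset_of_card_le {A B : Finset (Finset α)} (hA : IsInitial A)
    (hB : IsInitial B) (h : A.card ≤ B.card) : A ⊆ B := by
  rcases hA.subset_total hB with h' | h'
  · exact h'
  · exact (Finset.eq_of_subset_of_card_le h' h).ge

theorem IsInitial.card_union_le {A B : Finset (Finset α)} (hA : IsInitial A)
    (hB : IsInitial B) : (A ∪ B).card ≤ max A.card B.card := by
  rcases hA.subset_total hB with h | h
  · rw [Finset.union_eq_right.2 h]; exact le_max_right _ _
  · rw [Finset.union_eq_left.2 h]; exact le_max_left _ _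

theorem card_initialSegment_card (A : Finset (Finset α)) :
    (initialSegment α A.card).card = A.card :=
  card_initialSegment (card_le_two_pow A)

theorem IsInitial.eq_initialSegment {A : Finset (Finset α)} (hA : IsInitial A) :
    A = initialSegment α A.card :=
  Finset.eq_of_subset_of_card_le
    (hA.subset_of_card_le (isInitial_initialSegment _) (card_initialSegment_card A).ge)
    (card_initialSegment_card A).le

/-- Removing the largest element from the smaller of two sets of equal size leaves a set that does
not exceed any set obtained from the larger one by removing an element. -/
theorem simplicialLT_erase_max {y z : Finset α} (hcard : z.card = y.card) (h : SimplicialLT z y)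
    {i m : α} (hi : i ∈ y) (hm : m ∈ z) (hmax : ∀ j ∈ z, j ≤ m) :
    z.erase m = y.erase i ∨ SimplicialLT (z.erase m) (y.erase i) := by
  rcases h with h | ⟨-, d, hd, hmin, hdz⟩
  · omega
  have hc : (z.erase m).card = (y.erase i).card := by
    rw [Finset.card_erase_of_mem hm, Finset.card_erase_of_mem hi, hcard]
  have hbelow : ∀ j, j < d → (j ∈ z ↔ j ∈ y) := fun j hj => by
    have := hmin j
    grind [Finset.mem_symmDiff]
  have hdy : d ∉ y := by grind [Finset.mem_symmDiff]
  have hdm := hmax d hdz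
  rcases lt_or_ge i d with hid | hid
  · refine Or.inr (Or.inr ⟨hc, i, ?_, ?_, ?_⟩)
    · grind [Finset.mem_symmDiff]
    · intro j hj
      by_contra! hji
      have := hbelow j (hji.trans hid)
      grind [Finset.mem_symmDiff]
    · grind
  · rcases hdm.lt_or_eq with hdm | rfl
    · refine Or.inr (Or.inr ⟨hc, d, ?_, ?_, ?_⟩)
      · grind [Finset.mem_symmDiff]
      · intro j hj
        by_contra! hji
        have := hbelow j hji
        grind [Finset.mem_symmDiff]
      · grind
    -- Here `d` is the maximum of `z`, so all other elements of `z` lie below `d ≤ i`, where `z` and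
    -- `y` agree.
    · left
      refine Finset.eq_of_subset_of_card_le (fun j hj => ?_) hc.ge
      have h1 : j < d := by grind
      have := hbelow j h1
      grind

/-- A point of the ball outside `A` is some `x ∈ A` with an element added, since deleting an element
stays in `A`. If `z` precedes it, `z` without its maximum equals or precedes `x`, hence lies in `A`.
-/
theorem IsInitial.ball_one {A : Finset (Finset α)} (hA : IsInitial A) : IsInitial (ball 1 A) := by
  intro z y hzy hy
  by_cases hyA : y ∈ A
  · exact subset_ball 1 A (hA hzy hyA)
  by_cases hzA : z ∈ A
  · exact subset_ball 1 A hzA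
  obtain ⟨x, hx, hxy⟩ := mem_ball.1 hy
  obtain ⟨i, hi⟩ : ∃ i, symmDiff x y = {i} := by
    refine Finset.card_eq_one.1 (le_antisymm hxy (Finset.card_pos.2 ?_))
    rw [Finset.nonempty_iff_ne_empty]
    intro h0
    exact hyA (symmDiff_eq_bot.1 h0 ▸ hx)
  have hmem : ∀ j, (j ∈ symmDiff x y ↔ j = i) := fun j => by rw [hi]; simp
  simp only [Finset.mem_symmDiff] at hmem
  by_cases hix : i ∈ x
  · have : y = x.erase i := by ext j; grind
    have hlt : SimplicialLT y x := Or.inl (by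
      rw [this]; exact Finset.card_erase_lt_of_mem hix)
    exact absurd (hA hlt hx) hyA
  have hiy : i ∈ y := by grind
  have hxe : x = y.erase i := by ext j; grind
  have hcx : x.card + 1 = y.card := by rw [hxe]; exact Finset.card_erase_add_one hiy
  have hzne : z.Nonempty := by
    by_contra h0
    rw [Finset.not_nonempty_iff_eq_empty] at h0
    rcases eq_or_ne z x with h | h
    · exact hzA (h ▸ hx)
    · refine hzA (hA (Or.inl ?_) hx)
      have : x.Nonempty := Finset.nonempty_iff_ne_empty.2 fun h' => h (h0.trans h'.symm)
      simpa [h0] using this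
  have hm := z.max'_mem hzne
  set m := z.max' hzne with hmdef
  refine mem_ball.2 ⟨z.erase m, ?_, card_symmDiff_erase_le z m⟩
  have hcz : (z.erase m).card + 1 = z.card := Finset.card_erase_add_one hm
  by_cases hcard : z.card = y.card
  · rcases simplicialLT_erase_max hcard hzy hiy hm (fun j hj => z.le_max' j hj) with h | h
    · rw [h, ← hxe]; exact hx
    · rw [← hxe] at h; exact hA h hx
  · have : z.card < y.card := by
      rcases hzy with h | h
      · exact h
      · exact absurd h.1 hcard
    exact hA (Or.inl (by omega)) hx

theorem IsInitial.ball {A : Finset (Finset α)} (hA : IsInitial A) (t : ℕ) :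
    IsInitial (ball t A) := by
  induction t with
  | zero =>
    have : PowerCube.ball 0 A = A := by
      ext y
      simp only [mem_ball, Nat.le_zero, Finset.card_eq_zero]
      constructor
      · rintro ⟨x, hx, h⟩
        exact symmDiff_eq_bot.1 h ▸ hx
      · exact fun h => ⟨y, h, symmDiff_self y⟩
    rwa [this]
  | succ t ih => rw [ball_succ]; exact ih.ball_one

/-- `I \ S` and `S \ I` are equinumerous, and each member of the former precedes each member of the
latter. This makes compression terminate. -/
theorem sum_lt_sum_of_isInitial {I S : Finset (Finset α)} (hI : IsInitial I)
    (hcard : I.card = S.card) (hne : I ≠ S) {f : Finset α → ℕ}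
    (hf : ∀ x y, SimplicialLT x y → f x < f y) : ∑ x ∈ I, f x < ∑ x ∈ S, f x := by
  have hpos : 0 < (I \ S).card := by
    refine Finset.card_pos.2 (Finset.sdiff_nonempty.2 fun h => hne ?_)
    exact Finset.eq_of_subset_of_card_le h hcard.ge
  have hc : (I \ S).card = (S \ I).card := by
    have h1 := Finset.card_sdiff_add_card_inter I S
    have h2 := Finset.card_sdiff_add_card_inter S I
    rw [Finset.inter_comm] at h2
    omega
  obtain ⟨w, hw, hmax⟩ := Finset.exists_max_image (I \ S) f (Finset.card_pos.1 hpos)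
  have h1 : ∑ x ∈ I \ S, f x ≤ (I \ S).card • f w := Finset.sum_le_card_nsmul _ _ _ hmax
  have h2 : (S \ I).card • (f w + 1) ≤ ∑ x ∈ S \ I, f x := by
    refine Finset.card_nsmul_le_sum _ _ _ fun x hx => ?_
    rw [Finset.mem_sdiff] at hx hw
    refine hf _ _ ?_
    rcases SimplicialLT.total (x := w) (y := x) (by grind) with h | h
    · exact h
    · exact absurd (hI h hw.1) hx.2
  have h3 := Finset.sum_inter_add_sum_sdiff I S f
  have h4 := Finset.sum_inter_add_sum_sdiff S I f
  rw [Finset.inter_comm] at h4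
  rw [← hc] at h2
  simp only [smul_eq_mul] at h1 h2
  nlinarith

/-- The number of predecessors in the simplicial order. -/
def rank (y : Finset α) : ℕ := (Finset.univ.filter fun x : Finset α => SimplicialLT x y).card

theorem rank_lt_rank {x y : Finset α} (h : SimplicialLT x y) : rank x < rank y := by
  refine Finset.card_lt_card (Finset.ssubset_iff_of_subset (fun z hz => ?_) |>.2 ⟨x, ?_, ?_⟩)
  · simp only [Finset.mem_filter, Finset.mem_univ, true_and] at hz ⊢
    exact hz.trans h
  · simpa using h
  · simpa using SimplicialLT.irrefl x

end General

/-! ### Sections and compressions. -/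

section Sections

variable {n : ℕ}

/-- The subset of `Fin (n + 1)` whose trace off `i` is `x` and which contains `i` iff `b`. -/
def glue (i : Fin (n + 1)) (b : Bool) (x : Finset (Fin n)) : Finset (Fin (n + 1)) :=
  if b then insert i (x.map i.succAboveEmb) else x.map i.succAboveEmb

theorem self_mem_glue {i : Fin (n + 1)} {b : Bool} {x : Finset (Fin n)} :
    i ∈ glue i b x ↔ b = true := by
  cases b <;> simp [glue, Fin.succAbove_ne]

theorem succAbove_mem_glue {i : Fin (n + 1)} {b : Bool} {x : Finset (Fin n)} {j : Fin n} :
    i.succAbove j ∈ glue i b x ↔ j ∈ x := by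
  cases b <;> simp [glue, Fin.succAbove_ne]

theorem ext_succAbove (i : Fin (n + 1)) {x y : Finset (Fin (n + 1))} (h : i ∈ x ↔ i ∈ y)
    (h' : ∀ j, i.succAbove j ∈ x ↔ i.succAbove j ∈ y) : x = y := by
  ext k
  exact (Fin.forall_iff_succAbove (P := fun k => (k ∈ x ↔ k ∈ y)) i).2 ⟨h, h'⟩ k

/-- The trace of a subset of `Fin (n + 1)` off `i`. -/
def trace (i : Fin (n + 1)) (y : Finset (Fin (n + 1))) : Finset (Fin n) :=
  Finset.univ.filter fun j => i.succAbove j ∈ y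

theorem mem_trace {i : Fin (n + 1)} {y : Finset (Fin (n + 1))} {j : Fin n} :
    j ∈ trace i y ↔ i.succAbove j ∈ y := by
  simp [trace]

theorem glue_trace (i : Fin (n + 1)) (y : Finset (Fin (n + 1))) :
    glue i (decide (i ∈ y)) (trace i y) = y :=
  ext_succAbove i (by simp [self_mem_glue]) fun j => by rw [succAbove_mem_glue, mem_trace]

theorem glue_trace_of_iff {i : Fin (n + 1)} {b : Bool} {y : Finset (Fin (n + 1))}
    (h : i ∈ y ↔ b = true) : glue i b (trace i y) = y :=
  ext_succAbove i (by simp [self_mem_glue, h]) fun j => by rw [succAbove_mem_glue, mem_trace]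

theorem trace_glue (i : Fin (n + 1)) (b : Bool) (x : Finset (Fin n)) :
    trace i (glue i b x) = x := by
  ext j
  rw [mem_trace, succAbove_mem_glue]

theorem glue_injective (i : Fin (n + 1)) (b : Bool) : Function.Injective (glue i b) :=
  Function.LeftInverse.injective (trace_glue i b)

theorem card_glue (i : Fin (n + 1)) (b : Bool) (x : Finset (Fin n)) :
    (glue i b x).card = x.card + b.toNat := by
  cases b
  · simp [glue]
  · have : i ∉ x.map i.succAboveEmb := by simp [Fin.succAbove_ne]
    simp [glue, Finset.card_insert_of_notMem this]

theorem symmDiff_glue (i : Fin (n + 1)) (b c : Bool) (x y : Finset (Fin n)) :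
    symmDiff (glue i b x) (glue i c y) = glue i (xor b c) (symmDiff x y) := by
  refine ext_succAbove i ?_ fun j => ?_
  · rw [Finset.mem_symmDiff, self_mem_glue, self_mem_glue, self_mem_glue]
    cases b <;> cases c <;> simp
  · simp only [Finset.mem_symmDiff, succAbove_mem_glue]

theorem SimplicialLT.glue {x y : Finset (Fin n)} (h : SimplicialLT x y) (i : Fin (n + 1))
    (b : Bool) : SimplicialLT (glue i b x) (glue i b y) := by
  rcases h with h | ⟨h, d, hd, hmin, hdx⟩
  · left
    rw [card_glue, card_glue]
    omega
  · refine Or.inr ⟨by rw [card_glue, card_glue, h], i.succAbove d, ?_, ?_, ?_⟩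
    · rw [symmDiff_glue, succAbove_mem_glue]
      exact hd
    · rw [symmDiff_glue, Fin.forall_iff_succAbove i]
      refine ⟨fun hi => ?_, fun j hj => ?_⟩
      · rw [self_mem_glue] at hi
        simp at hi
      · rw [succAbove_mem_glue] at hj
        exact (Fin.strictMono_succAbove i).monotone (hmin j hj)
    · rwa [succAbove_mem_glue]

theorem SimplicialLT.of_glue {x y : Finset (Fin n)} {i : Fin (n + 1)} {b : Bool}
    (h : SimplicialLT (PowerCube.glue i b x) (PowerCube.glue i b y)) : SimplicialLT x y := by
  by_contra hn
  rcases eq_or_ne x y with rfl | hne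
  · exact SimplicialLT.irrefl _ h
  · exact SimplicialLT.irrefl _ (h.trans (((SimplicialLT.total hne).resolve_left hn).glue i b))

/-- The section of a family: the traces off `i` of the members containing `i` (for `b = true`) or
avoiding `i` (for `b = false`). -/
def sec (i : Fin (n + 1)) (b : Bool) (A : Finset (Finset (Fin (n + 1)))) : Finset (Finset (Fin n)) :=
  Finset.univ.filter fun x => glue i b x ∈ A

theorem mem_sec {i : Fin (n + 1)} {b : Bool} {A : Finset (Finset (Fin (n + 1)))}
    {x : Finset (Fin n)} : x ∈ sec i b A ↔ glue i b x ∈ A := by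
  simp [sec]

theorem sum_eq_sum_sec (i : Fin (n + 1)) (A : Finset (Finset (Fin (n + 1))))
    (f : Finset (Fin (n + 1)) → ℕ) :
    ∑ y ∈ A, f y =
      ∑ x ∈ sec i false A, f (glue i false x) + ∑ x ∈ sec i true A, f (glue i true x) := by
  have key : ∀ b, ∑ x ∈ sec i b A, f (glue i b x) = ∑ y ∈ A with (i ∈ y ↔ b = true), f y := by
    intro b
    refine Finset.sum_bij (fun x _ => glue i b x) ?_ ?_ ?_ ?_
    · intro x hx
      exact Finset.mem_filter.2 ⟨mem_sec.1 hx, self_mem_glue⟩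
    · exact fun x _ y _ h => glue_injective i b h
    · intro y hy
      rw [Finset.mem_filter] at hy
      exact ⟨trace i y, mem_sec.2 ((glue_trace_of_iff hy.2).symm ▸ hy.1), glue_trace_of_iff hy.2⟩
    · exact fun _ _ => rfl
  rw [key, key, add_comm (Finset.sum _ _), ← Finset.sum_filter_add_sum_filter_not A (fun y => i ∈ y)]
  simp

theorem card_eq_card_sec (i : Fin (n + 1)) (A : Finset (Finset (Fin (n + 1)))) :
    A.card = (sec i false A).card + (sec i true A).card := by
  simpa using sum_eq_sum_sec i A fun _ => 1

theorem sec_ball (i : Fin (n + 1)) (b : Bool) (A : Finset (Finset (Fin (n + 1)))) :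
    sec i b (ball 1 A) = ball 1 (sec i b A) ∪ sec i (!b) A := by
  ext y
  rw [Finset.mem_union, mem_sec, mem_ball, mem_ball, mem_sec]
  constructor
  · rintro ⟨x, hx, hxy⟩
    rw [← glue_trace i x] at hx hxy
    rw [symmDiff_glue, card_glue] at hxy
    by_cases hb : decide (i ∈ x) = b
    · rw [hb] at hx
      exact Or.inl ⟨trace i x, mem_sec.2 hx, by omega⟩
    · have hb' : decide (i ∈ x) = !b := by
        revert hb; cases decide (i ∈ x) <;> cases b <;> simp
      rw [hb'] at hx hxy
      have h1 : ((!b) ^^ b).toNat = 1 := by cases b <;> rfl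
      have h0 : (symmDiff (trace i x) y).card = 0 := by omega
      have : trace i x = y := symmDiff_eq_bot.1 (Finset.card_eq_zero.1 h0)
      exact Or.inr (this ▸ hx)
  · rintro (⟨x, hx, hxy⟩ | h)
    · exact ⟨glue i b x, mem_sec.1 hx, by rw [symmDiff_glue, card_glue]; simpa using hxy⟩
    · refine ⟨_, h, ?_⟩
      rw [symmDiff_glue, card_glue]
      cases b <;> simp

/-- The `i`-compression of a family: both sections are replaced by initial segments. -/
def compress (i : Fin (n + 1)) (A : Finset (Finset (Fin (n + 1)))) :
    Finset (Finset (Fin (n + 1))) :=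
  Finset.univ.filter fun y => trace i y ∈ initialSegment (Fin n) (sec i (decide (i ∈ y)) A).card

theorem sec_compress (i : Fin (n + 1)) (b : Bool) (A : Finset (Finset (Fin (n + 1)))) :
    sec i b (compress i A) = initialSegment (Fin n) (sec i b A).card := by
  ext x
  have : decide (i ∈ glue i b x) = b := by simp [self_mem_glue]
  simp only [mem_sec, compress, Finset.mem_filter, Finset.mem_univ, true_and, trace_glue, this]

theorem card_compress (i : Fin (n + 1)) (A : Finset (Finset (Fin (n + 1)))) :
    (compress i A).card = A.card := by
  rw [card_eq_card_sec i, card_eq_card_sec i A, sec_compress, sec_compress,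
    card_initialSegment_card, card_initialSegment_card]

/-- The vertex-isoperimetric inequality in the cube of dimension `n`. -/
def HarperInequality (n : ℕ) : Prop :=
  ∀ A : Finset (Finset (Fin n)), (ball 1 (initialSegment (Fin n) A.card)).card ≤ (ball 1 A).card

/-- By `sec_ball` each section of the ball is a union of two families. After compression both are
initial, hence nested, so the union is only as large as the larger one. -/
theorem HarperInequality.card_ball_compress_le (h : HarperInequality n) (i : Fin (n + 1))
    (A : Finset (Finset (Fin (n + 1)))) : (ball 1 (compress i A)).card ≤ (ball 1 A).card := by
  have key : ∀ b, (sec i b (ball 1 (compress i A))).card ≤ (sec i b (ball 1 A)).card := by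
    intro b
    rw [sec_ball, sec_ball, sec_compress, sec_compress]
    refine ((isInitial_initialSegment _).ball_one.card_union_le
      (isInitial_initialSegment _)).trans (max_le ?_ ?_)
    · exact (h _).trans (Finset.card_le_card Finset.subset_union_left)
    · rw [card_initialSegment_card]
      exact Finset.card_le_card Finset.subset_union_right
  rw [card_eq_card_sec i, card_eq_card_sec i (ball 1 A)]
  exact add_le_add (key _) (key _)

theorem sum_rank_compress_lt {i : Fin (n + 1)} {A : Finset (Finset (Fin (n + 1)))} {b : Bool}
    (hA : ¬ IsInitial (sec i b A)) : ∑ x ∈ compress i A, rank x < ∑ x ∈ A, rank x := by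
  have hlt : ∀ c, initialSegment (Fin n) (sec i c A).card ≠ sec i c A →
      ∑ x ∈ sec i c (compress i A), rank (glue i c x) < ∑ x ∈ sec i c A, rank (glue i c x) := by
    intro c hc
    rw [sec_compress]
    exact sum_lt_sum_of_isInitial (isInitial_initialSegment _) (card_initialSegment_card _) hc
      (f := fun x => rank (glue i c x)) fun x y hxy => rank_lt_rank (hxy.glue i c)
  have hle : ∀ c,
      ∑ x ∈ sec i c (compress i A), rank (glue i c x) ≤ ∑ x ∈ sec i c A, rank (glue i c x) := by
    intro c
    by_cases hc : initialSegment (Fin n) (sec i c A).card = sec i c A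
    · rw [sec_compress, hc]
    · exact (hlt c hc).le
  have hb := hlt b fun h => hA (h ▸ isInitial_initialSegment _)
  rw [sum_eq_sum_sec i, sum_eq_sum_sec i A]
  cases b
  · exact add_lt_add_of_lt_of_le hb (hle _)
  · exact add_lt_add_of_le_of_lt (hle _) hb

/-! ### Families all of whose sections are initial. -/

/-- If every section of a family is an initial segment, then a set outside the family can only
precede a member of the family if the two are complementary. -/
theorem eq_compl_of_isInitial_sec {A : Finset (Finset (Fin (n + 1)))}
    (hA : ∀ i b, IsInitial (sec i b A)) {x y : Finset (Fin (n + 1))} (hxy : SimplicialLT x y)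
    (hx : x ∉ A) (hy : y ∈ A) : y = xᶜ := by
  by_contra hne
  -- If `x` and `y` agree at `i`, they lie in the same `i`-section, whose initiality forces `x ∈ A`.
  obtain ⟨i, hi⟩ : ∃ i, (i ∈ x ↔ i ∈ y) := by
    by_contra! h
    refine hne ?_
    ext i
    have := h i
    rw [Finset.mem_compl]
    tauto
  have h1 := glue_trace_of_iff (i := i) (b := decide (i ∈ y)) (y := x) (by simp [hi])
  have h2 := glue_trace i y
  have hlt : SimplicialLT (glue i (decide (i ∈ y)) (trace i x))
      (glue i (decide (i ∈ y)) (trace i y)) := by rwa [h1, h2]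
  have := mem_sec.1 (hA i _ hlt.of_glue (mem_sec.2 (h2.symm ▸ hy)))
  exact hx (h1 ▸ this)

theorem simplicialLT_exchange {α : Type*} [Fintype α] [LinearOrder α] {x : Finset α} {j k : α}
    (hj : j ∉ x) (hk : k ∈ x) (hjk : j < k) : SimplicialLT ((insert j x).erase k) x := by
  refine Or.inr ⟨?_, j, ?_, ?_, ?_⟩
  · rw [Finset.card_erase_of_mem (by simp [hk]), Finset.card_insert_of_notMem hj]
    simp
  · grind [Finset.mem_symmDiff]
  · intro l hl
    grind [Finset.mem_symmDiff]
  · grind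

theorem simplicialLT_exchange' {α : Type*} [Fintype α] [LinearOrder α] {x : Finset α} {j k : α}
    (hj : j ∉ x) (hk : k ∈ x) (hjk : k < j) : SimplicialLT x ((insert j x).erase k) := by
  refine Or.inr ⟨?_, k, ?_, ?_, hk⟩
  · rw [Finset.card_erase_of_mem (by simp [hk]), Finset.card_insert_of_notMem hj]
    simp
  · grind [Finset.mem_symmDiff]
  · intro l hl
    grind [Finset.mem_symmDiff]

/-- If a set and its complement are consecutive in the simplicial order of a cube of dimension at
least three, the first of them contains the last element of the ground set. -/
theorem last_mem_of_consecutive_compl (hn : 2 ≤ n) {x : Finset (Fin (n + 1))}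
    (hx : SimplicialLT x xᶜ) (hcons : ∀ z, SimplicialLT x z → ¬ SimplicialLT z xᶜ) :
    Fin.last n ∈ x := by
  by_contra hl
  have hcc := Finset.card_add_card_compl x
  rw [Fintype.card_fin] at hcc
  have hlast : ∀ k ∈ x, k < Fin.last n := fun k hk =>
    lt_of_le_of_ne (Fin.le_last k) fun h => hl (h ▸ hk)
  have hexc : ∀ k ∈ x, ((insert (Fin.last n) x).erase k).card = x.card := fun k hk => by
    rw [Finset.card_erase_of_mem (by simp [hk]), Finset.card_insert_of_notMem hl]
    simp
  rcases hx with hc | ⟨hc, d, hd, hmin, hdx⟩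
  · rcases x.eq_empty_or_nonempty with rfl | ⟨k, hk⟩
    · refine hcons {0} (Or.inl (by simp)) (Or.inl ?_)
      simp only [Finset.card_singleton, Finset.card_empty] at hcc ⊢
      omega
    · refine hcons _ (simplicialLT_exchange' hl hk (hlast k hk)) (Or.inl ?_)
      rw [hexc k hk]
      exact hc
  -- Dimension at least three gives `x` a second element `k`. Trading `k` for the last element moves
  -- past `x`, but keeping `d`, the least element of the ground set, stays before `xᶜ`.
  · obtain ⟨k, hk, hkd⟩ := Finset.exists_mem_ne (s := x) (by omega) d
    refine hcons _ (simplicialLT_exchange' hl hk (hlast k hk)) (Or.inr ⟨?_, d, ?_, ?_, ?_⟩)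
    · rw [hexc k hk, hc]
    · grind [Finset.mem_symmDiff]
    · intro j _
      refine hmin j ?_
      rw [Finset.mem_symmDiff, Finset.mem_compl]
      tauto
    · grind

/-- If `A` is not initial, it consists of all predecessors of some `x` together with `xᶜ`, the
successor of `x`. Replacing `xᶜ` by `x` gives the initial segment, and every neighbour of `x` is
already in the ball about the predecessors of `x`. -/
theorem card_ball_le_of_isInitial_sec (hn : 2 ≤ n) {A : Finset (Finset (Fin (n + 1)))}
    (hA : ∀ i b, IsInitial (sec i b A)) :
    (ball 1 (initialSegment (Fin (n + 1)) A.card)).card ≤ (ball 1 A).card := by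
  by_cases hI : IsInitial A
  · rw [← hI.eq_initialSegment]
  obtain ⟨x, y, hxy, hy, hx⟩ : ∃ x y, SimplicialLT x y ∧ y ∈ A ∧ x ∉ A := by
    simpa [IsInitial] using hI
  obtain rfl := eq_compl_of_isInitial_sec hA hxy hx hy
  have hbelow : ∀ z, SimplicialLT z xᶜ → z ≠ x → z ∈ A := fun z hz hne => by
    by_contra hzA
    exact hne (compl_injective (eq_compl_of_isInitial_sec hA hz hzA hy).symm)
  have habove : ∀ z, SimplicialLT x z → z ≠ xᶜ → z ∉ A := fun z hz hne hzA =>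
    hne (eq_compl_of_isInitial_sec hA hz hx hzA)
  have hcons : ∀ z, SimplicialLT x z → ¬ SimplicialLT z xᶜ := by
    intro z h1 h2
    have hzx : z ≠ x := by rintro rfl; exact SimplicialLT.irrefl _ h1
    have hzy : z ≠ xᶜ := by rintro rfl; exact SimplicialLT.irrefl _ h2
    exact habove z h1 hzy (hbelow z h2 hzx)
  have hlast := last_mem_of_consecutive_compl hn hxy hcons
  have hlt : ∀ z, SimplicialLT z x → z ∈ A := fun z hz =>
    hbelow z (hz.trans hxy) (by rintro rfl; exact SimplicialLT.irrefl _ hz)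
  have herase : ∀ k ∈ x, x.erase k ∈ A := fun k hk =>
    hlt _ (Or.inl (Finset.card_erase_lt_of_mem hk))
  set I := insert x (A.erase xᶜ) with hIdef
  have hne : x ≠ xᶜ := by
    intro h
    exact hx (h ▸ hy)
  have hIc : I.card = A.card := by
    rw [hIdef, Finset.card_insert_of_notMem (by simp [hx]), Finset.card_erase_add_one hy]
  have hAx : ∀ z ∈ A.erase xᶜ, SimplicialLT z x := fun z hz => by
    rw [Finset.mem_erase] at hz
    have hzx : z ≠ x := by rintro rfl; exact hx hz.2
    exact (SimplicialLT.total hzx).resolve_right fun h => habove z h hz.1 hz.2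
  have hII : IsInitial I := by
    intro w z hwz hz
    have hwx : SimplicialLT w x := by
      rcases Finset.mem_insert.1 hz with rfl | hz
      · exact hwz
      · exact hwz.trans (hAx z hz)
    refine Finset.mem_insert_of_mem (Finset.mem_erase.2 ⟨?_, hlt w hwx⟩)
    rintro rfl
    exact SimplicialLT.irrefl _ (hwx.trans hxy)
  rw [← hIc, ← hII.eq_initialSegment]
  refine Finset.card_le_card fun w hw => ?_
  obtain ⟨z, hz, hzw⟩ := mem_ball.1 hw
  rcases Finset.mem_insert.1 hz with rfl | hz
  · by_cases hwz : w ⊆ z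
    · rcases hwz.eq_or_ssubset with rfl | hwz
      · exact mem_ball.2 ⟨_, herase _ hlast, card_symmDiff_erase_le _ _⟩
      · exact subset_ball 1 A (hlt w (Or.inl (Finset.card_lt_card hwz)))
    · obtain ⟨j, hjw, hjz⟩ := Finset.not_subset.1 hwz
      have hw' : w = insert j z := by
        have h1 := Finset.card_le_one.1 hzw j (by grind [Finset.mem_symmDiff])
        ext k
        have := h1 k
        grind [Finset.mem_symmDiff]
      have hjl : j < Fin.last n := lt_of_le_of_ne (Fin.le_last j) (by rintro rfl; exact hjz hlast)
      -- Dropping the last element from `insert j z` gives a predecessor of `z`; this is where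
      -- `hlast` is needed.
      refine mem_ball.2 ⟨_, hlt _ (simplicialLT_exchange hjz hlast hjl), ?_⟩
      rw [hw']
      exact card_symmDiff_erase_le _ _
  · exact mem_ball.2 ⟨z, Finset.mem_of_mem_erase hz, hzw⟩

/-! ### Harper's theorem and passage to complements. -/

theorem harperInequality (n : ℕ) : HarperInequality n := by
  match n with
  -- Small cubes are checked by enumeration: in dimensions 1 and 2 the pairs `∅`, `{0}` and `{0}`,
  -- `{1}` are consecutive complements whose first set misses the last element.
  | 0 => unfold HarperInequality; decide +kernel
  | 1 => unfold HarperInequality; decide +kernel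
  | 2 => unfold HarperInequality; decide +kernel
  | n + 3 =>
    have ih := harperInequality (n + 2)
    intro A
    induction hs : ∑ x ∈ A, rank x using Nat.strong_induction_on generalizing A with
    | _ s hind =>
      by_cases h : ∀ i b, IsInitial (sec i b A)
      · exact card_ball_le_of_isInitial_sec (by omega) h
      · push Not at h
        obtain ⟨i, b, hib⟩ := h
        have := hind _ (hs ▸ sum_rank_compress_lt hib) (compress i A) rfl
        rw [card_compress] at this
        exact this.trans (ih.card_ball_compress_le i A)

theorem card_ball_initialSegment_le (t : ℕ) (A : Finset (Finset (Fin n))) :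
    (ball t (initialSegment (Fin n) A.card)).card ≤ (ball t A).card := by
  induction t with
  | zero =>
    refine le_of_eq_of_le ?_ (Finset.card_le_card (subset_ball 0 A))
    have : ball 0 (initialSegment (Fin n) A.card) = initialSegment (Fin n) A.card := by
      ext y
      simp [mem_ball]
    rw [this, card_initialSegment_card]
  | succ t ih =>
    rw [ball_succ t A, ball_succ t (initialSegment _ _)]
    refine (Finset.card_le_card (ball_mono ?_)).trans (harperInequality n (ball t A))
    -- Initial families are nested by size, so the bound for radius `t` becomes an inclusion.
    refine ((isInitial_initialSegment _).ball t).subset_of_card_le (isInitial_initialSegment _) ?_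
    rwa [card_initialSegment_card]

theorem card_symmDiff_compl_add (x y : Finset (Fin n)) :
    (symmDiff x yᶜ).card + (symmDiff x y).card = n := by
  have : symmDiff x yᶜ = (symmDiff x y)ᶜ := by
    ext k
    simp only [Finset.mem_symmDiff, Finset.mem_compl]
    tauto
  rw [this, add_comm, Finset.card_add_card_compl, Fintype.card_fin]

/-- A set is close to all members of a family iff its complement is far from all of them. -/
theorem card_commonNear_add_card_ball {p t : ℕ} (h : p + t + 1 = n)
    (A : Finset (Finset (Fin n))) : (commonNear p A).card + (ball t A).card = 2 ^ n := by
  have : (commonNear p A).card = (ball t A)ᶜ.card := by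
    refine Finset.card_bij' (fun y _ => yᶜ) (fun y _ => yᶜ) ?_ ?_ (by simp) (by simp)
    · intro y hy
      simp only [commonNear, Finset.mem_filter, Finset.mem_univ, true_and] at hy
      rw [Finset.mem_compl, mem_ball]
      rintro ⟨x, hx, hxy⟩
      have := card_symmDiff_compl_add x y
      have := hy x hx
      omega
    · intro y hy
      simp only [commonNear, Finset.mem_filter, Finset.mem_univ, true_and]
      intro x hx
      by_contra hlt
      rw [Finset.mem_compl, mem_ball] at hy
      have := card_symmDiff_compl_add x y
      exact hy ⟨x, hx, by omega⟩
  rw [this, add_comm, Finset.card_add_card_compl]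
  simp

end Sections

end PowerCube

theorem theorem3p3 (n p : ℕ) (A : Finset (Finset (Fin n))) :
    (PowerCube.commonNear p A).card ≤
      (PowerCube.commonNear p (PowerCube.initialSegment (Fin n) A.card)).card := by
  rcases le_or_gt n p with h | h
  · refine Finset.card_le_card fun y _ => ?_
    simp only [PowerCube.commonNear, Finset.mem_filter, Finset.mem_univ, true_and]
    exact fun x _ => (Finset.card_le_univ _).trans (by simpa using h)
  · obtain ⟨t, ht⟩ : ∃ t, p + t + 1 = n := ⟨n - p - 1, by omega⟩
    have h1 := PowerCube.card_commonNear_add_card_ball ht A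
    have h2 := PowerCube.card_commonNear_add_card_ball ht
      (PowerCube.initialSegment (Fin n) A.card)
    have h3 := PowerCube.card_ball_initialSegment_le t A
    omega
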